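/- Let $G^-$ and $G^+$ be entire functions with $G^-(1/2)=G^+(1/2)$ and $(G^-)'(1/2)\neq (G^+)'(1/2)$. Define $g:\mathbb R\to\mathbb C$ by $g(b)=G^-(b)$ if $b<1/2$ and $g(b)=G^+(b)$ if $b\ge 1/2$, and put $\psi_0(a)=g((1+a)/2)$. Call a sequence $\boldsymbol\epsilon=(\epsilon_N)_{N\ge1}$ in $[0,1[$ tending to $0$ a null sequence, and put $r^{\boldsymbol\epsilon}_{N,\nu}=1-2\,\frac{\nu+\epsilon_N(N-\nu)}{N}$ and $w_{N,\nu}(a)=\binom N\nu\big(\frac{1+a}2\big)^{N-\nu}\big(\frac{1-a}2\big)^{\nu}$ for $N\ge1$, $0\le\nu\le N$. A continuous function $\varphi:A\to\mathbb C$ on an open interval $A$ of length larger than $2$ is called a regular $\mathbb C$-supershift on $A$ if, for every null sequence $\boldsymbol\epsilon$, the functions $(a,a')\mapsto\sum_{\nu=0}^N w_{N,\nu}(a)\,\varphi(a'+r^{\boldsymbol\epsilon}_{N,\nu})$ converge to $\varphi(a+a')$ as $N\to\infty$, uniformly on the compact subsets of $\mathbb A=\{(a,a')\in\mathbb R\times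 A: a'+[-1,1]\subset A,\ a+a'\in A\}$, and if moreover, for every family of null sequences that tend to $0$ uniformly over the family, this convergence on each compact subset of $\mathbb A$ is also uniform over the family. Then there is $\rho_0>0$ such that $\psi_0$ is a regular $\mathbb C$-supershift on $A_0=\,]-1-\rho_0,1+\rho_0[$, and for every such $\rho_0$ the following holds. The function $$\Theta_{\rho_0}(a)=\frac{2(1+\rho_0)}{\pi}\arctan\Big(a\tan\frac{\pi}{2(1+\rho_0)}\Big)$$ is a real-analytic homeomorphism of $\mathbb R$ onto $A_0$. For every null sequence $\boldsymbol\epsilon$, the nodes $h^{\boldsymbol\epsilon}_{\rho_0,N,\nu}=\Theta_{\rho_0}^{-1}(r^{\boldsymbol\epsilon}_{N,\nu})$ ($N\ge1$, $0\le\nu\le N$) are well defined, lie in $[-1,1]$ and are non-increasing in $\nu$. The function $\psi=\psi_0\circ\Theta_{\rho_0}:\mathbb R\to\mathbb C$ is continuous and is not real-analytic on $\mathbb R$. For every null sequence $\boldsymbol\epsilon$, the functions $$a\in\mathbb R\longmapsto\sum_{\nu=0}^N\binom N\nu\Big(\frac{1+\Theta_{\rho_0}(a)}2\Big)^{N-\nu}\Big(\frac{1-\Theta_{\rho_0}(a)}2\Big)^{\nu}\psi(h^{\boldsymbol\epsilon}_{\rho_0,N,\nu}),\qquad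 N\ge1,$$ are real-analytic and converge to $\psi$, as $N\to\infty$, uniformly on every compact subset of $\mathbb R$. Moreover, for every family of null sequences that tend to $0$ uniformly over the family, the convergence on each compact subset of $\mathbb R$ is uniform over the family. -/

import Mathlib

open Set Filter Topology

noncomputable section

namespace Supershift

/-- The sequences `(ε_N)_{N ≥ 1}` of elements of `[0,1[` that tend to `0`.
The value at `N = 0` plays no role. -/
def IsNullSeq (ε : ℕ → ℝ) : Prop :=
  (∀ N, 1 ≤ N → 0 ≤ ε N ∧ ε N < 1) ∧ Tendsto ε atTop (𝓝 0)

/-- A family of such sequences tending to `0` uniformly with respect to the member of the family.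
A family is given by the set of its members. -/
def IsUniformNullFamily (E : Set (ℕ → ℝ)) : Prop :=
  (∀ ε ∈ E, IsNullSeq ε) ∧ TendstoUniformlyOn (fun N (ε : ℕ → ℝ) => ε N) (fun _ => 0) atTop E

/-- The regular nodes `1 - 2 (ν + ε_N (N - ν)) / N`, for `N ≥ 1` and `0 ≤ ν ≤ N`. -/
def regularNode (ε : ℕ → ℝ) (N ν : ℕ) : ℝ :=
  1 - 2 * (((ν : ℝ) + ε N * ((N : ℝ) - ν)) / N)

/-- The Bernstein-type weight `binom(N, ν) ((1 + a)/2)^(N-ν) ((1 - a)/2)^ν`, for `ν ≤ N`. -/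
def weight (N ν : ℕ) (a : ℝ) : ℂ :=
  (((N.choose ν : ℝ) * ((1 + a) / 2) ^ (N - ν) * ((1 - a) / 2) ^ ν : ℝ) : ℂ)

/-- The domain `{(a, a') : a' + [-1,1] ⊆ A, a + a' ∈ A}`. -/
def shiftDomain (A : Set ℝ) : Set (ℝ × ℝ) :=
  {p | (∀ t ∈ Icc (-1 : ℝ) 1, p.2 + t ∈ A) ∧ p.1 + p.2 ∈ A}

/-- The sums `∑_ν weight_ν(a) ψ(a' + h_ν)` on the regular nodes. -/
def shiftSum (ψ : ℝ → ℂ) (ε : ℕ → ℝ) (N : ℕ) (p : ℝ × ℝ) : ℂ :=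
  ∑ ν ∈ Finset.range (N + 1), weight N ν p.1 * ψ (p.2 + regularNode ε N ν)

/-- The translation-commuting supershift property on `A` of a continuous map `ψ : A → ℂ`, with
respect to the superoscillating sequence attached to the regular sampling given by `ε`. -/
def TCSP (A : Set ℝ) (ψ : ℝ → ℂ) (ε : ℕ → ℝ) : Prop :=
  ContinuousOn ψ A ∧
    ∀ K ⊆ shiftDomain A, IsCompact K →
      TendstoUniformlyOn (shiftSum ψ ε) (fun p => ψ (p.1 + p.2)) atTop K

/-- `ψ` is a regular `ℂ`-supershift on the open interval `A` of length larger than `2`.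
Only the values of `ψ` on `A` matter. -/
structure IsRegularSupershift (A : Set ℝ) (ψ : ℝ → ℂ) : Prop where
  isOpen : IsOpen A
  ordConnected : A.OrdConnected
  length : ∃ x ∈ A, ∃ y ∈ A, 2 < y - x
  continuousOn : ContinuousOn ψ A
  tcsp : ∀ ε : ℕ → ℝ, IsNullSeq ε → TCSP A ψ ε
  uniform : ∀ E : Set (ℕ → ℝ), IsUniformNullFamily E →
    ∀ K ⊆ shiftDomain A, IsCompact K → ∀ δ > 0, ∃ N₀ : ℕ, ∀ N ≥ N₀, ∀ ε ∈ E, ∀ p ∈ K,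
      ‖shiftSum ψ ε N p - ψ (p.1 + p.2)‖ < δ

/-- The glued function `g` on `ℝ`: `G⁻` on `b < 1/2` and `G⁺` on `b ≥ 1/2`. -/
def glue (Gm Gp : ℂ → ℂ) (b : ℝ) : ℂ :=
  if b < 1 / 2 then Gm b else Gp b

/-- `ψ₀(a) = g((1 + a)/2)`. -/
def psi0 (Gm Gp : ℂ → ℂ) (a : ℝ) : ℂ :=
  glue Gm Gp ((1 + a) / 2)

/-- The interval `A₀ = ]-1-ρ₀, 1+ρ₀[`. -/
def A0 (ρ₀ : ℝ) : Set ℝ := Ioo (-1 - ρ₀) (1 + ρ₀)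

/-- `Θ_{ρ₀}(a) = (2(1+ρ₀)/π) arctan(a tan(π/(2(1+ρ₀))))`. -/
def Theta (ρ₀ a : ℝ) : ℝ :=
  2 * (1 + ρ₀) / Real.pi * Real.arctan (a * Real.tan (Real.pi / (2 * (1 + ρ₀))))

/-- The irregular nodes `Θ_{ρ₀}⁻¹(regular node)`. -/
def irregularNode (ρ₀ : ℝ) (ε : ℕ → ℝ) (N ν : ℕ) : ℝ :=
  Function.invFun (Theta ρ₀) (regularNode ε N ν)

/-- `ψ = ψ₀ ∘ Θ_{ρ₀}`. -/
def psi (Gm Gp : ℂ → ℂ) (ρ₀ : ℝ) : ℝ → ℂ :=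
  psi0 Gm Gp ∘ Theta ρ₀

/-- The extrapolating sums
`∑_ν binom(N, ν) ((1 + Θ(a))/2)^(N-ν) ((1 - Θ(a))/2)^ν f(h_{ρ₀,N,ν})`. -/
def extrapolation (ρ₀ : ℝ) (f : ℝ → ℂ) (ε : ℕ → ℝ) (N : ℕ) (a : ℝ) : ℂ :=
  ∑ ν ∈ Finset.range (N + 1), weight N ν (Theta ρ₀ a) * f (irregularNode ρ₀ ε N ν)

end Supershift

end

namespace Supershift

/-! With `x = (1 + a)/2` and the summation reversed, a supershift sum of `psi0` is a Bernstein sum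
of the glued function at the points `a'/2 + (1 - ε_N) k / N`. It has to converge slightly outside
`[0, 1]` too.

On `[0, 1]` this is Bernstein's theorem, proved by the variance estimate; the shift and dilation of
the nodes cost only uniform continuity. For `x < 0` the limit is the value of `Gm`. Bernstein sums
of an entire function converge on all of `ℂ` (`exists_norm_bernsteinSum_entire_sub_le`), so only the
difference between the glued function and `Gm` matters. It lives on nodes beyond `1/2`, where `k` is
about `N/2` or more and `|x|^k |1 - x|^(N-k)` is at most `(2/5)^N`; the binomials add up to `2^N`,
so the error is `O((4/5)^N)`. For `x > 1`, `Gp` plays the same role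
(`exists_bernsteinSum_glue_close`).

The map `Theta` then transports everything: the extrapolating sum at `a` is the supershift sum at
`(Theta a, 0)` (`extrapolation_psi`). Analyticity fails at `0`, which `Theta` fixes and where the
one-sided derivatives of `psi` are the distinct numbers `Gm'(1/2)` and `Gp'(1/2)` times a common
positive factor. -/

/-! ### Bernstein sums of entire functions. -/

/-- The Bernstein sum `∑ₖ binom(N, k) xᵏ (1 - x)^(N-k) f(k)`. -/
def bernsteinSum (N : ℕ) (x : ℂ) (f : ℕ → ℂ) : ℂ :=
  ∑ k ∈ Finset.range (N + 1), (N.choose k : ℂ) * x ^ k * (1 - x) ^ (N - k) * f k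

theorem bernsteinSum_add (N : ℕ) (x : ℂ) (f g : ℕ → ℂ) :
    bernsteinSum N x (fun k => f k + g k) = bernsteinSum N x f + bernsteinSum N x g := by
  simp only [bernsteinSum, mul_add, Finset.sum_add_distrib]

theorem bernsteinSum_sub (N : ℕ) (x : ℂ) (f g : ℕ → ℂ) :
    bernsteinSum N x (fun k => f k - g k) = bernsteinSum N x f - bernsteinSum N x g := by
  simp only [bernsteinSum, mul_sub, Finset.sum_sub_distrib]

theorem bernsteinSum_const_mul (N : ℕ) (x c : ℂ) (f : ℕ → ℂ) :
    bernsteinSum N x (fun k => c * f k) = c * bernsteinSum N x f := by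
  simp only [bernsteinSum, Finset.mul_sum]
  exact Finset.sum_congr rfl fun k _ => by ring

theorem bernsteinSum_one (N : ℕ) (x : ℂ) : bernsteinSum N x (fun _ => 1) = 1 := by
  have h := add_pow x (1 - x) N
  rw [add_sub_cancel, one_pow] at h
  refine Eq.trans ?_ h.symm
  exact Finset.sum_congr rfl fun k _ => by ring

theorem bernsteinSum_hasSum (N : ℕ) (x : ℂ) {u : ℕ → ℕ → ℂ} {f : ℕ → ℂ}
    (h : ∀ k, HasSum (fun j => u j k) (f k)) :
    HasSum (fun j => bernsteinSum N x (u j)) (bernsteinSum N x f) :=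
  hasSum_sum fun k _ => (h k).mul_left _

theorem bernsteinSum_succ_natCast_mul (N : ℕ) (x : ℂ) (f : ℕ → ℂ) :
    bernsteinSum (N + 1) x (fun k => (k : ℂ) * f k) =
      ((N : ℂ) + 1) * x * bernsteinSum N x (fun k => f (k + 1)) := by
  rw [bernsteinSum, Finset.sum_range_succ', bernsteinSum, Finset.mul_sum]
  simp only [Nat.cast_zero, zero_mul, mul_zero, add_zero]
  refine Finset.sum_congr rfl fun k _ => ?_
  have h : ((N : ℂ) + 1) * (N.choose k : ℂ) = ((N + 1).choose (k + 1) : ℂ) * ((k : ℂ) + 1) := by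
    exact_mod_cast Nat.add_one_mul_choose_eq N k
  rw [Nat.add_sub_add_right]
  push_cast
  linear_combination (-(x ^ (k + 1) * (1 - x) ^ (N - k) * f (k + 1))) * h

/-- Splitting off one factor `d + h k` leaves a term in `k`, which the absorption identity for
binomials turns into a sum of degree `N` with `d` moved to `d + h`. This recursion drives the
induction on the exponent. -/
theorem bernsteinSum_affine_pow_succ (N : ℕ) (x d h : ℂ) (j : ℕ) :
    bernsteinSum (N + 1) x (fun k => (d + h * k) ^ (j + 1)) =
      d * bernsteinSum (N + 1) x (fun k => (d + h * k) ^ j) +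
        h * ((N : ℂ) + 1) * x * bernsteinSum N x (fun k => ((d + h) + h * k) ^ j) := by
  have e : (fun k : ℕ => (d + h * k) ^ (j + 1)) =
      fun k : ℕ => d * (d + h * k) ^ j + h * ((k : ℂ) * (d + h * k) ^ j) := by
    funext k; ring
  have e' : (fun k : ℕ => (d + h * ((k + 1 : ℕ) : ℂ)) ^ j) =
      fun k : ℕ => ((d + h) + h * k) ^ j := by
    funext k; push_cast; ring
  rw [e, bernsteinSum_add, bernsteinSum_const_mul, bernsteinSum_const_mul,
    bernsteinSum_succ_natCast_mul N x (fun k => (d + h * k) ^ j), e']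
  ring

theorem norm_pow_sub_pow_le {T : ℝ} (hT : 1 ≤ T) {a b : ℂ} (ha : ‖a‖ ≤ T) (hb : ‖b‖ ≤ T) (j : ℕ) :
    ‖a ^ j - b ^ j‖ ≤ j * ‖a - b‖ * T ^ j := by
  induction j with
  | zero => simp
  | succ j ih =>
    have hT0 : (0 : ℝ) ≤ T := by linarith
    have e : a ^ (j + 1) - b ^ (j + 1) = a * (a ^ j - b ^ j) + (a - b) * b ^ j := by ring
    rw [e]
    calc ‖a * (a ^ j - b ^ j) + (a - b) * b ^ j‖
        ≤ ‖a‖ * ‖a ^ j - b ^ j‖ + ‖a - b‖ * ‖b‖ ^ j := by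
          refine (norm_add_le _ _).trans ?_
          rw [norm_mul, norm_mul, norm_pow]
      _ ≤ T * (j * ‖a - b‖ * T ^ j) + ‖a - b‖ * T ^ (j + 1) := by
          have : ‖b‖ ^ j ≤ T ^ (j + 1) :=
            (pow_le_pow_left₀ (norm_nonneg _) hb j).trans (pow_le_pow_right₀ hT (by omega))
          gcongr
      _ = ((j + 1 : ℕ) : ℝ) * ‖a - b‖ * T ^ (j + 1) := by push_cast; ring

/-- Induction on `j`, with `N` and `d` free because the recursion changes both. Each step adds an
error of order `h j`, hence the factor `j ^ 2`; polynomial growth in `j` is what allows summation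
against Taylor coefficients. -/
theorem norm_bernsteinSum_affine_pow_sub_le {x : ℂ} {R T h : ℝ} (hR : 1 ≤ R) (hx : ‖x‖ ≤ R)
    (hT : 1 ≤ T) (hh : 0 ≤ h) (j : ℕ) :
    ∀ (N : ℕ) (d : ℂ), ‖d‖ + h * N * R ≤ T →
      ‖bernsteinSum N x (fun k => (d + h * k) ^ j) - (d + h * N * x) ^ j‖ ≤
        2 * R * h * j ^ 2 * T ^ j := by
  have hT0 : (0 : ℝ) ≤ T := by linarith
  have hR0 : (0 : ℝ) ≤ R := by linarith
  induction j with
  | zero => intro N d _; simp [bernsteinSum_one]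
  | succ j ih =>
    intro N d hd
    rcases N with _ | N
    · have : bernsteinSum 0 x (fun k => (d + h * k) ^ (j + 1)) = d ^ (j + 1) := by
        simp [bernsteinSum]
      rw [this]
      simp only [Nat.cast_zero, mul_zero, zero_mul, add_zero, sub_self, norm_zero]
      positivity
    · rw [bernsteinSum_affine_pow_succ]
      push_cast at hd ⊢
      have hdh : ‖d + h‖ ≤ ‖d‖ + h := by
        refine (norm_add_le _ _).trans ?_
        rw [Complex.norm_real, Real.norm_of_nonneg hh]
      have hhR : h ≤ h * R := le_mul_of_one_le_right hh hR
      have h1 := ih (N + 1) d (by push_cast; linarith)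
      -- `R ≥ 1` keeps the budget: `‖d + h‖ + h N R ≤ ‖d‖ + h (N + 1) R`.
      have h2 := ih N (d + h) (by nlinarith)
      push_cast at h1
      have hxn : ‖(h : ℂ) * (N + 1) * x‖ ≤ h * (N + 1) * R := by
        rw [norm_mul, norm_mul, Complex.norm_real, Real.norm_of_nonneg hh]
        have : ‖(N : ℂ) + 1‖ = (N : ℝ) + 1 := by
          exact_mod_cast Complex.norm_natCast (N + 1)
        rw [this]; gcongr
      have hxn' : ‖(h : ℂ) * N * x‖ ≤ h * N * R := by
        rw [norm_mul, norm_mul, Complex.norm_real, Real.norm_of_nonneg hh, Complex.norm_natCast]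
        gcongr
      have h3 : ‖((d + h) + h * N * x) ^ j - (d + h * (N + 1) * x) ^ j‖ ≤ j * (h * (2 * R)) * T ^ j := by
        refine (norm_pow_sub_pow_le hT ?_ ?_ j).trans ?_
        · refine (norm_add_le _ _).trans ?_
          nlinarith
        · exact (norm_add_le _ _).trans (by linarith)
        · have e : (d + h) + h * N * x - (d + h * (N + 1) * x) = h * (1 - x) := by ring
          have : ‖1 - x‖ ≤ 2 * R := by
            refine (norm_sub_le _ _).trans ?_
            rw [norm_one]; linarith
          rw [e, norm_mul, Complex.norm_real, Real.norm_of_nonneg hh]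
          gcongr
      set S₁ := bernsteinSum (N + 1) x (fun k => (d + h * k) ^ j)
      set S₂ := bernsteinSum N x (fun k => ((d + h) + h * k) ^ j)
      have e : d * S₁ + h * (N + 1) * x * S₂ - (d + h * (N + 1) * x) ^ (j + 1) =
          d * (S₁ - (d + h * (N + 1) * x) ^ j) +
          h * (N + 1) * x * ((S₂ - ((d + h) + h * N * x) ^ j) +
            (((d + h) + h * N * x) ^ j - (d + h * (N + 1) * x) ^ j)) := by ring
      rw [e]
      calc _ ≤ ‖d‖ * (2 * R * h * j ^ 2 * T ^ j) +
            h * (N + 1) * R * (2 * R * h * j ^ 2 * T ^ j + j * (h * (2 * R)) * T ^ j) := by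
            refine (norm_add_le _ _).trans ?_
            rw [norm_mul, norm_mul ((h : ℂ) * (N + 1) * x)]
            gcongr
            exact (norm_add_le _ _).trans (add_le_add h2 h3)
        _ ≤ (‖d‖ + h * (N + 1) * R) * (2 * R * h * j ^ 2 * T ^ j + j * (h * (2 * R)) * T ^ j) := by
            have : 0 ≤ ‖d‖ * (j * (h * (2 * R)) * T ^ j) := by positivity
            linarith
        _ ≤ T * (2 * R * h * j ^ 2 * T ^ j + j * (h * (2 * R)) * T ^ j) := by gcongr
        _ ≤ 2 * R * h * ((j : ℝ) + 1) ^ 2 * T ^ (j + 1) := by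
            have : 0 ≤ 2 * R * h * ((j : ℝ) + 1) * T ^ (j + 1) := by positivity
            rw [pow_succ T j] at this ⊢
            linarith

/-- Bernstein sums of an entire function converge at the rate `1 / N`, also outside `[0, 1]`. -/
theorem exists_norm_bernsteinSum_entire_sub_le {G : ℂ → ℂ} (hG : Differentiable ℂ G) {R T : ℝ}
    (hR : 1 ≤ R) (hT : 1 ≤ T) :
    ∃ C : ℝ, 0 ≤ C ∧ ∀ (N : ℕ) (x d : ℂ) (h : ℝ), ‖x‖ ≤ R → 0 ≤ h → ‖d‖ + h * N * R ≤ T →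
      ‖bernsteinSum N x (fun k => G (d + h * k)) - G (d + h * N * x)‖ ≤ C * h := by
  obtain ⟨c, hc⟩ : ∃ c : ℕ → ℂ, ∀ z, HasSum (fun j => c j * z ^ j) (G z) := by
    refine ⟨fun j => (j.factorial : ℂ)⁻¹ * iteratedDeriv j G 0, fun z => ?_⟩
    refine (Complex.hasSum_taylorSeries_of_entire hG 0 z).congr_fun fun j => ?_
    rw [smul_eq_mul, smul_eq_mul, sub_zero]; ring
  have hT0 : (0 : ℝ) ≤ T := by linarith
  have hsum : Summable fun j : ℕ => ‖c j‖ * ((j : ℝ) ^ 2 * T ^ j) := by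
    -- Since `j ≤ 2 ^ j`, the weight `j ^ 2 * T ^ j` is at most `(4 T) ^ j`, and the Taylor series
    -- converges absolutely at `4 T`.
    have h4 : Summable fun j : ℕ => ‖c j * ((4 * T : ℝ) : ℂ) ^ j‖ :=
      summable_norm_iff.2 (hc ((4 * T : ℝ) : ℂ)).summable
    refine Summable.of_nonneg_of_le (fun j => by positivity) (fun j => ?_) h4
    rw [norm_mul, norm_pow, Complex.norm_real, Real.norm_of_nonneg (by positivity), mul_pow]
    gcongr
    have : (j : ℝ) ≤ 2 ^ j := by exact_mod_cast Nat.lt_two_pow_self.le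
    calc (j : ℝ) ^ 2 ≤ (2 ^ j) ^ 2 := by gcongr
      _ = 4 ^ j := by rw [← pow_mul, mul_comm, pow_mul]; norm_num
  refine ⟨2 * R * ∑' j : ℕ, ‖c j‖ * ((j : ℝ) ^ 2 * T ^ j), ?_, fun N x d h hx hh hd => ?_⟩
  · have : 0 ≤ ∑' j : ℕ, ‖c j‖ * ((j : ℝ) ^ 2 * T ^ j) := tsum_nonneg fun j => by positivity
    positivity
  have hs : HasSum
      (fun j => c j * (bernsteinSum N x (fun k => (d + h * k) ^ j) - (d + h * N * x) ^ j))
      (bernsteinSum N x (fun k => G (d + h * k)) - G (d + h * N * x)) := by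
    simp only [mul_sub, ← bernsteinSum_const_mul]
    exact (bernsteinSum_hasSum N x fun k => hc _).sub (hc (d + h * N * x))
  rw [← hs.tsum_eq]
  have hb : ∀ j : ℕ, ‖c j * (bernsteinSum N x (fun k => (d + h * k) ^ j) - (d + h * N * x) ^ j)‖ ≤
      2 * R * h * (‖c j‖ * ((j : ℝ) ^ 2 * T ^ j)) := fun j => by
    rw [norm_mul]
    have := mul_le_mul_of_nonneg_left
      (norm_bernsteinSum_affine_pow_sub_le hR hx hT hh j N d hd) (norm_nonneg (c j))
    linarith
  refine (tsum_of_norm_bounded (hsum.mul_left (2 * R * h)).hasSum hb).trans_eq ?_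
  rw [tsum_mul_left]; ring

/-! ### Exponentially small weights. -/

theorem norm_bernsteinSum_le {N : ℕ} {x : ℂ} {f : ℕ → ℂ} {M q : ℝ}
    (hq : ∀ k ≤ N, f k ≠ 0 → ‖x‖ ^ k * ‖1 - x‖ ^ (N - k) ≤ q) (hq0 : 0 ≤ q)
    (hM : ∀ k ≤ N, ‖f k‖ ≤ M) :
    ‖bernsteinSum N x f‖ ≤ M * (2 ^ N * q) := by
  have hM0 : 0 ≤ M := (norm_nonneg _).trans (hM 0 (Nat.zero_le _))
  have h2 : ((2 : ℝ) ^ N) = ∑ k ∈ Finset.range (N + 1), (N.choose k : ℝ) := by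
    exact_mod_cast (Nat.sum_range_choose N).symm
  rw [h2, Finset.sum_mul, Finset.mul_sum]
  refine norm_sum_le_of_le _ fun k hk => ?_
  have hk : k ≤ N := Nat.lt_succ_iff.1 (Finset.mem_range.1 hk)
  by_cases h0 : f k = 0
  · rw [h0, mul_zero, norm_zero]; positivity
  · rw [norm_mul, norm_mul, norm_mul, norm_pow, norm_pow, Complex.norm_natCast, mul_comm, mul_assoc]
    have := hq k hk h0
    have := hM k hk
    gcongr

/-- The base `2/5` must be below `1/2` to beat the binomial total `2 ^ N`. The number `19/50` lies
just above the fourth root of `1/50`, and `19/50 * (51/50) < 2/5`. -/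
theorem pow_mul_pow_le_of_quarter {y z : ℝ} (hy : 0 ≤ y) (hy' : y ≤ 1 / 50) (hz : 0 ≤ z)
    (hz' : z ≤ 51 / 50) {m N : ℕ} (hm : N ≤ 4 * m) :
    y ^ m * z ^ (N - m) ≤ (2 / 5) ^ N := by
  calc y ^ m * z ^ (N - m) ≤ (19 / 50) ^ N * (51 / 50) ^ N := by
        have h1 : y ^ m ≤ (19 / 50 : ℝ) ^ N :=
          calc y ^ m ≤ ((19 / 50 : ℝ) ^ 4) ^ m := by gcongr; exact hy'.trans (by norm_num)
            _ = (19 / 50 : ℝ) ^ (4 * m) := (pow_mul _ _ _).symm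
            _ ≤ (19 / 50 : ℝ) ^ N := pow_le_pow_of_le_one (by norm_num) (by norm_num) hm
        have h2 : z ^ (N - m) ≤ (51 / 50 : ℝ) ^ N :=
          (pow_le_pow_left₀ hz hz' _).trans (pow_le_pow_right₀ (by norm_num) (Nat.sub_le _ _))
        gcongr
    _ = (19 / 50 * (51 / 50)) ^ N := (mul_pow _ _ _).symm
    _ ≤ (2 / 5) ^ N := by gcongr; norm_num

/-! ### Bernstein's theorem on the unit interval. -/

theorem sum_bernstein_eq_one (N : ℕ) (x : ℝ) :
    ∑ k ∈ Finset.range (N + 1), (N.choose k : ℝ) * x ^ k * (1 - x) ^ (N - k) = 1 := by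
  have h := add_pow x (1 - x) N
  rw [add_sub_cancel, one_pow] at h
  refine Eq.trans ?_ h.symm
  exact Finset.sum_congr rfl fun k _ => by ring

theorem sum_bernstein_mul_sq_le {N : ℕ} (hN : N ≠ 0) {x : ℝ} (hx : x ∈ Icc (0 : ℝ) 1) :
    ∑ k ∈ Finset.range (N + 1), (N.choose k : ℝ) * x ^ k * (1 - x) ^ (N - k) *
      ((k : ℝ) / N - x) ^ 2 ≤ 1 / (N : ℝ) := by
  have h := bernstein.variance hN ⟨x, hx⟩
  simp only [bernstein_apply, bernstein.z] at h
  rw [Finset.sum_range]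
  calc _ = x * (1 - x) / N := by
        rw [← h]
        exact Finset.sum_congr rfl fun k _ => by ring
    _ ≤ 1 / (N : ℝ) := by
        gcongr
        nlinarith [hx.1, hx.2]

/-- The interval `[-2, 3]` is wide enough for every node and evaluation point used below. -/
theorem exists_modulus {φ : ℝ → ℂ} (hφ : Continuous φ) {δ : ℝ} (hδ : 0 < δ) :
    ∃ η > 0, ∀ u ∈ Icc (-2 : ℝ) 3, ∀ v ∈ Icc (-2 : ℝ) 3, |u - v| < η → ‖φ u - φ v‖ < δ := by
  obtain ⟨η, hη, h⟩ := Metric.uniformContinuousOn_iff.1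
    (isCompact_Icc.uniformContinuousOn_of_continuous (hφ.continuousOn (s := Icc (-2 : ℝ) 3))) δ hδ
  exact ⟨η, hη, fun u hu v hv huv => by
    simpa [dist_eq_norm] using h u hu v hv (by simpa [Real.dist_eq] using huv)⟩

theorem exists_bound {φ : ℝ → ℂ} (hφ : Continuous φ) :
    ∃ M, 0 ≤ M ∧ ∀ u ∈ Icc (-2 : ℝ) 3, ‖φ u‖ ≤ M := by
  obtain ⟨M, hM⟩ := isCompact_Icc.exists_bound_of_continuousOn
    (hφ.continuousOn (s := Icc (-2 : ℝ) 3))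
  exact ⟨M, (norm_nonneg _).trans (hM 0 (by norm_num)), hM⟩

theorem scaled_node_mem {s : ℝ} (hs0 : 0 ≤ s) (hs1 : s ≤ 1) {k N : ℕ} (hk : k ≤ N) :
    s * k / N ∈ Icc (0 : ℝ) 1 := by
  have hkN : (k : ℝ) ≤ N := by exact_mod_cast hk
  refine ⟨by positivity, div_le_one_of_le₀ ?_ (by positivity)⟩
  nlinarith [(Nat.cast_nonneg k : (0 : ℝ) ≤ k)]

/-- Bernstein's theorem on `[0, 1]`, uniformly in a translation and a dilation of the nodes. -/
theorem exists_bernsteinSum_close_of_mem_Icc {φ : ℝ → ℂ} (hφ : Continuous φ) {δ : ℝ} (hδ : 0 < δ) :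
    ∃ η > 0, ∃ N₀ : ℕ, ∀ N ≥ N₀, ∀ s x α : ℝ, 0 ≤ s → s ≤ 1 → 1 - s < η → x ∈ Icc (0 : ℝ) 1 →
      |α| ≤ 1 → ‖bernsteinSum N x (fun k => φ (α + s * k / N)) - φ (α + x)‖ < δ := by
  obtain ⟨η, hη, hmod⟩ := exists_modulus hφ (show 0 < δ / 4 by positivity)
  obtain ⟨M, hM0, hM⟩ := exists_bound hφ
  obtain ⟨N₁, hN₁⟩ := exists_nat_gt (2 * M / η ^ 2 / (δ / 4))
  refine ⟨η, hη, N₁ + 1, fun N hN s x α hs0 hs1 hs hx hα => ?_⟩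
  have hN0 : N ≠ 0 := by omega
  have hNpos : (0 : ℝ) < N := by positivity
  obtain ⟨hα1, hα2⟩ := abs_le.1 hα
  -- The dilation costs `δ / 4`. Nodes near `x` cost another `δ / 4`; for far ones, Chebyshev's
  -- trick bounds the oscillation `2 M` by the quadratic term, whose mean is `O(1 / N)`.
  have hterm : ∀ k ≤ N, ‖φ (α + s * k / N) - φ (α + x)‖ ≤
      δ / 2 + 2 * M / η ^ 2 * ((k : ℝ) / N - x) ^ 2 := by
    intro k hk
    have hk1 := scaled_node_mem hs0 hs1 hk
    have hk2 := scaled_node_mem zero_le_one le_rfl hk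
    rw [one_mul] at hk2
    have m1 : α + s * k / N ∈ Icc (-2 : ℝ) 3 := ⟨by linarith [hk1.1], by linarith [hk1.2]⟩
    have m2 : α + k / N ∈ Icc (-2 : ℝ) 3 := ⟨by linarith [hk2.1], by linarith [hk2.2]⟩
    have m3 : α + x ∈ Icc (-2 : ℝ) 3 := ⟨by linarith [hx.1], by linarith [hx.2]⟩
    have a1 : ‖φ (α + s * k / N) - φ (α + k / N)‖ ≤ δ / 4 := by
      refine (hmod _ m1 _ m2 ?_).le
      have e : α + s * k / N - (α + k / N) = -((1 - s) * (k / N)) := by ring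
      rw [e, abs_neg, abs_of_nonneg (mul_nonneg (by linarith) hk2.1)]
      exact lt_of_le_of_lt (mul_le_of_le_one_right (by linarith) hk2.2) hs
    have a2 : ‖φ (α + k / N) - φ (α + x)‖ ≤ δ / 4 + 2 * M / η ^ 2 * ((k : ℝ) / N - x) ^ 2 := by
      by_cases hd : |(k : ℝ) / N - x| < η
      · have h1 := hmod _ m2 _ m3 (by rwa [add_sub_add_left_eq_sub])
        have : 0 ≤ 2 * M / η ^ 2 * ((k : ℝ) / N - x) ^ 2 := by positivity
        linarith
      · have hsq : η ^ 2 ≤ ((k : ℝ) / N - x) ^ 2 := by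
          rw [← sq_abs ((k : ℝ) / N - x)]
          exact pow_le_pow_left₀ hη.le (not_lt.1 hd) 2
        have : 2 * M ≤ 2 * M / η ^ 2 * ((k : ℝ) / N - x) ^ 2 := by
          rw [div_mul_eq_mul_div, le_div_iff₀ (by positivity)]
          gcongr
        have := (norm_sub_le (φ (α + k / N)) (φ (α + x)))
        linarith [hM _ m2, hM _ m3]
    have := norm_sub_le_norm_sub_add_norm_sub (φ (α + s * k / N)) (φ (α + k / N)) (φ (α + x))
    linarith
  have hconst : φ (α + x) = bernsteinSum N x (fun _ => φ (α + x)) := by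
    have := bernsteinSum_const_mul N x (φ (α + x)) (fun _ => 1)
    rw [bernsteinSum_one] at this
    simpa using this.symm
  rw [hconst, ← bernsteinSum_sub]
  have hx1 : 0 ≤ 1 - x := by linarith [hx.2]
  have hx0 : 0 ≤ x := hx.1
  calc ‖bernsteinSum N x (fun k => φ (α + s * k / N) - φ (α + x))‖
      ≤ ∑ k ∈ Finset.range (N + 1), (N.choose k : ℝ) * x ^ k * (1 - x) ^ (N - k) *
          (δ / 2 + 2 * M / η ^ 2 * ((k : ℝ) / N - x) ^ 2) := by
        refine norm_sum_le_of_le _ fun k hk => ?_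
        have hk : k ≤ N := Nat.lt_succ_iff.1 (Finset.mem_range.1 hk)
        have e : ((N.choose k : ℂ) * x ^ k * (1 - x) ^ (N - k)) =
            (((N.choose k : ℝ) * x ^ k * (1 - x) ^ (N - k) : ℝ) : ℂ) := by push_cast; rfl
        rw [norm_mul, e, Complex.norm_real, Real.norm_of_nonneg (by positivity)]
        have := hterm k hk
        gcongr
    _ = δ / 2 * ∑ k ∈ Finset.range (N + 1), (N.choose k : ℝ) * x ^ k * (1 - x) ^ (N - k) +
        2 * M / η ^ 2 * ∑ k ∈ Finset.range (N + 1), (N.choose k : ℝ) * x ^ k * (1 - x) ^ (N - k) *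
          ((k : ℝ) / N - x) ^ 2 := by
        rw [Finset.mul_sum, Finset.mul_sum, ← Finset.sum_add_distrib]
        exact Finset.sum_congr rfl fun k _ => by ring
    _ ≤ δ / 2 * 1 + 2 * M / η ^ 2 * (1 / N) := by
        rw [sum_bernstein_eq_one]
        have := sum_bernstein_mul_sq_le hN0 hx
        gcongr
    _ < δ := by
        have hlt : 2 * M / η ^ 2 / (δ / 4) < N := hN₁.trans_le (by exact_mod_cast (by omega))
        rw [div_lt_iff₀ (by positivity)] at hlt
        have : 2 * M / η ^ 2 * (1 / N) < δ / 4 := by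
          rw [mul_one_div, div_lt_iff₀ hNpos]; linarith
        linarith


/-! ### Convergence for the glued function near the unit interval. -/

theorem continuous_glue {Gm Gp : ℂ → ℂ} (hGm : Differentiable ℂ Gm) (hGp : Differentiable ℂ Gp)
    (hval : Gm (1 / 2) = Gp (1 / 2)) : Continuous (glue Gm Gp) := by
  have h : glue Gm Gp = fun b : ℝ => if b ≥ 1 / 2 then Gp b else Gm b := by
    funext b
    by_cases hb : b < 1 / 2
    · simp only [glue, if_pos hb, if_neg (not_le.2 hb)]
    · simp only [glue, if_neg hb, if_pos (not_lt.1 hb)]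
  rw [h]
  refine Continuous.if_le (hGp.continuous.comp Complex.continuous_ofReal)
    (hGm.continuous.comp Complex.continuous_ofReal) continuous_const continuous_id ?_
  intro b hb
  simp only [← show (1 / 2 : ℝ) = b from hb]
  push_cast
  exact hval.symm

/-- If a bounded function agrees with an entire function except where the weights are exponentially
small, its Bernstein sums converge to the entire function. -/
theorem exists_bernsteinSum_close_of_eq {g : ℝ → ℂ} (hg : Continuous g) {G : ℂ → ℂ}
    (hG : Differentiable ℂ G) {δ : ℝ} (hδ : 0 < δ) :
    ∃ η > 0, ∃ N₀ : ℕ, ∀ N ≥ N₀, ∀ s x α : ℝ, 0 ≤ s → s ≤ 1 → 1 - s < η →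
      x ∈ Icc (-(1 / 50) : ℝ) (51 / 50) → |α| ≤ 1 / 100 →
      (∀ k ≤ N, g (α + s * k / N) ≠ G (α + s * k / N : ℝ) →
        |x| ^ k * |1 - x| ^ (N - k) ≤ (2 / 5) ^ N) →
      ‖bernsteinSum N x (fun k => g (α + s * k / N)) - G (α + x : ℝ)‖ < δ := by
  have hGc : Continuous fun b : ℝ => G b := hG.continuous.comp Complex.continuous_ofReal
  obtain ⟨η, hη, hmod⟩ := exists_modulus hGc (show 0 < δ / 3 by positivity)
  obtain ⟨M, hM0, hM⟩ := exists_bound (hg.sub hGc)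
  obtain ⟨C, hC0, hC⟩ := exists_norm_bernsteinSum_entire_sub_le hG (R := 2) (T := 3)
    (by norm_num) (by norm_num)
  obtain ⟨N₁, hN₁⟩ := exists_nat_gt (C / (δ / 3))
  have htend : Tendsto (fun N : ℕ => M * (2 ^ N * (2 / 5 : ℝ) ^ N)) atTop (𝓝 0) := by
    have := (tendsto_pow_atTop_nhds_zero_of_lt_one (r := (4 / 5 : ℝ)) (by norm_num)
      (by norm_num)).const_mul M
    rw [mul_zero] at this
    refine this.congr fun N => ?_
    rw [← mul_pow]; norm_num
  obtain ⟨N₂, hN₂⟩ := eventually_atTop.1 (htend.eventually_lt_const (show 0 < δ / 3 by positivity))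
  -- Half of `η` suffices since `|x| ≤ 2`: replacing `s * x` by `x` then moves the argument by less
  -- than `η`.
  refine ⟨η / 2, by positivity, max (N₁ + 1) N₂, fun N hN s x α hs0 hs1 hs hx hα hbad => ?_⟩
  have hN1 : N₁ + 1 ≤ N := (le_max_left _ _).trans hN
  have hNpos : (0 : ℝ) < N := by exact_mod_cast (by omega : 0 < N)
  have hNC : (N : ℂ) ≠ 0 := by exact_mod_cast hNpos.ne'
  obtain ⟨hα1, hα2⟩ := abs_le.1 hα
  obtain ⟨hx1, hx2⟩ := hx
  have habs : |x| ≤ 2 := abs_le.2 ⟨by linarith, by linarith⟩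
  have a1 : ‖bernsteinSum N x (fun k => g (α + s * k / N) - G (α + s * k / N : ℝ))‖ < δ / 3 := by
    refine (norm_bernsteinSum_le (M := M) (q := (2 / 5) ^ N) (fun k hk hne => ?_) (by positivity)
      (fun k hk => hM _ ?_)).trans_lt (hN₂ N ((le_max_right _ _).trans hN))
    · have e : (1 : ℂ) - x = ((1 - x : ℝ) : ℂ) := by push_cast; rfl
      rw [e, Complex.norm_real, Complex.norm_real, Real.norm_eq_abs, Real.norm_eq_abs]
      exact hbad k hk (sub_ne_zero.1 hne)
    · have := scaled_node_mem hs0 hs1 hk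
      exact ⟨by linarith [this.1], by linarith [this.2]⟩
  have a2 : ‖bernsteinSum N x (fun k => G (α + s * k / N : ℝ)) - G (α + s * x : ℝ)‖ < δ / 3 := by
    have h := hC N x α (s / N) (by rw [Complex.norm_real]; exact habs) (by positivity) (by
      rw [Complex.norm_real, Real.norm_eq_abs, div_mul_cancel₀ _ hNpos.ne']; linarith)
    have e1 : (fun k : ℕ => G ((α : ℂ) + ((s / N : ℝ) : ℂ) * k)) =
        fun k : ℕ => G (α + s * k / N : ℝ) := by
      funext k; congr 1; push_cast; ring
    have e2 : (α : ℂ) + ((s / N : ℝ) : ℂ) * N * x = ((α + s * x : ℝ) : ℂ) := by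
      push_cast; field_simp
    rw [e1, e2] at h
    refine h.trans_lt ?_
    have hlt : C / (δ / 3) < N := hN₁.trans_le (by exact_mod_cast (by omega))
    rw [div_lt_iff₀ (by positivity)] at hlt
    rw [mul_div_assoc', div_lt_iff₀ hNpos]
    nlinarith
  have a3 : ‖G (α + s * x : ℝ) - G (α + x : ℝ)‖ < δ / 3 := by
    refine hmod _ ⟨?_, ?_⟩ _ ⟨by linarith, by linarith⟩ ?_
    · nlinarith
    · nlinarith
    · have e : α + s * x - (α + x) = -((1 - s) * x) := by ring
      rw [e, abs_neg, abs_mul, abs_of_nonneg (by linarith : 0 ≤ 1 - s)]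
      nlinarith
  rw [bernsteinSum_sub] at a1
  have t := norm_add₃_le (a := bernsteinSum N x (fun k => g (α + s * k / N)) -
      bernsteinSum N x (fun k => G (α + s * k / N : ℝ)))
    (b := bernsteinSum N x (fun k => G (α + s * k / N : ℝ)) - G (α + s * x : ℝ))
    (c := G (α + s * x : ℝ) - G (α + x : ℝ))
  rw [sub_add_sub_cancel, sub_add_sub_cancel] at t
  linarith

/-- Bernstein sums of the glued function converge on a neighbourhood of `[0, 1]`. -/
theorem exists_bernsteinSum_glue_close {Gm Gp : ℂ → ℂ} (hGm : Differentiable ℂ Gm)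
    (hGp : Differentiable ℂ Gp) (hval : Gm (1 / 2) = Gp (1 / 2)) {δ : ℝ} (hδ : 0 < δ) :
    ∃ η > 0, ∃ N₀ : ℕ, ∀ N ≥ N₀, ∀ s x α : ℝ, s ≤ 1 → 1 - s < η →
      x ∈ Icc (-(1 / 50) : ℝ) (51 / 50) → |α| ≤ 1 / 100 →
      ‖bernsteinSum N x (fun k => glue Gm Gp (α + s * k / N)) - glue Gm Gp (α + x)‖ < δ := by
  have hg := continuous_glue hGm hGp hval
  obtain ⟨η₁, hη₁, N₁, h₁⟩ := exists_bernsteinSum_close_of_mem_Icc hg hδ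
  obtain ⟨η₂, hη₂, N₂, h₂⟩ := exists_bernsteinSum_close_of_eq hg hGm hδ
  obtain ⟨η₃, hη₃, N₃, h₃⟩ := exists_bernsteinSum_close_of_eq hg hGp hδ
  -- The bound `1/4` forces `s > 3/4`. For `x > 1`, nodes left of `1/2` satisfy `s k / N < 51/100`,
  -- so this gives `4 k ≤ 3 N`, that is `N - k ≥ N / 4`.
  refine ⟨min (min η₁ η₂) (min η₃ (1 / 4)), by positivity, N₁ + N₂ + N₃ + 1,
    fun N hN s x α hs1 hs hx hα => ?_⟩
  have hsη₁ : 1 - s < η₁ := hs.trans_le ((min_le_left _ _).trans (min_le_left _ _))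
  have hsη₂ : 1 - s < η₂ := hs.trans_le ((min_le_left _ _).trans (min_le_right _ _))
  have hsη₃ : 1 - s < η₃ := hs.trans_le ((min_le_right _ _).trans (min_le_left _ _))
  have hs4 : 1 - s < 1 / 4 := hs.trans_le ((min_le_right _ _).trans (min_le_right _ _))
  have hs0 : 0 ≤ s := by linarith
  have hNpos : (0 : ℝ) < N := by exact_mod_cast (by omega : 0 < N)
  obtain ⟨hα1, hα2⟩ := abs_le.1 hα
  rcases lt_or_ge x 0 with hx0 | hx0
  · have hlt : α + x < 1 / 2 := by linarith
    have e : glue Gm Gp (α + x) = Gm (α + x : ℝ) := if_pos hlt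
    rw [e]
    refine h₂ N (by omega) s x α hs0 hs1 hsη₂ hx hα fun k hk hne => ?_
    -- The glued function differs from `Gm` only at nodes `≥ 1/2`; as `s ≤ 1` and `|α| ≤ 1/100`,
    -- there `k ≥ 49 N / 100`.
    have hge : 1 / 2 ≤ α + s * k / N := by
      by_contra hcon
      exact hne (if_pos (not_le.1 hcon))
    refine pow_mul_pow_le_of_quarter (abs_nonneg _) ?_ (abs_nonneg _) ?_ ?_
    · exact abs_le.2 ⟨by linarith [hx.1], by linarith⟩
    · exact abs_le.2 ⟨by linarith [hx.1], by linarith [hx.1]⟩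
    · have h4 : 49 / 100 ≤ s * k / N := by linarith
      rw [le_div_iff₀ hNpos] at h4
      have : (N : ℝ) ≤ 4 * k := by nlinarith [(Nat.cast_nonneg k : (0 : ℝ) ≤ k)]
      exact_mod_cast this
  rcases le_or_gt x 1 with hx1 | hx1
  · exact h₁ N (by omega) s x α hs0 hs1 hsη₁ ⟨hx0, hx1⟩ (by linarith)
  · have hge : ¬ α + x < 1 / 2 := by linarith
    have e : glue Gm Gp (α + x) = Gp (α + x : ℝ) := if_neg hge
    rw [e]
    refine h₃ N (by omega) s x α hs0 hs1 hsη₃ hx hα fun k hk hne => ?_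
    have hlt : α + s * k / N < 1 / 2 := by
      by_contra hcon
      exact hne (if_neg hcon)
    have h := pow_mul_pow_le_of_quarter (y := |1 - x|) (z := |x|) (m := N - k) (N := N)
      (abs_nonneg _) ?_ (abs_nonneg _) ?_ ?_
    · rwa [Nat.sub_sub_self hk, mul_comm] at h
    · exact abs_le.2 ⟨by linarith [hx.2], by linarith⟩
    · exact abs_le.2 ⟨by linarith [hx.2], by linarith [hx.2]⟩
    · have h4 : s * k / N < 51 / 100 := by linarith
      rw [div_lt_iff₀ hNpos] at h4
      have : 4 * (k : ℝ) ≤ 3 * N := by nlinarith [(Nat.cast_nonneg k : (0 : ℝ) ≤ k)]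
      have : 4 * k ≤ 3 * N := by exact_mod_cast this
      omega

theorem shiftSum_psi0 (Gm Gp : ℂ → ℂ) (ε : ℕ → ℝ) {N : ℕ} (hN : 1 ≤ N) (p : ℝ × ℝ) :
    shiftSum (psi0 Gm Gp) ε N p = bernsteinSum N (((1 + p.1) / 2 : ℝ) : ℂ)
      (fun k => glue Gm Gp (p.2 / 2 + (1 - ε N) * k / N)) := by
  have hN0 : (N : ℝ) ≠ 0 := by positivity
  rw [shiftSum, bernsteinSum, ← Finset.sum_range_reflect]
  refine Finset.sum_congr rfl fun k hk => ?_
  have hk : k ≤ N := Nat.lt_succ_iff.1 (Finset.mem_range.1 hk)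
  have e : N + 1 - 1 - k = N - k := by omega
  have e1 : (1 + (p.2 + regularNode ε N (N - k))) / 2 = p.2 / 2 + (1 - ε N) * k / N := by
    rw [regularNode, Nat.cast_sub hk]
    field_simp
    ring
  have e2 : (1 - p.1) / 2 = 1 - (1 + p.1) / 2 := by ring
  rw [e, psi0, e1, weight, Nat.choose_symm hk, Nat.sub_sub_self hk, e2]
  push_cast
  rfl

theorem isUniformNullFamily_singleton {ε : ℕ → ℝ} (hε : IsNullSeq ε) :
    IsUniformNullFamily {ε} :=
  ⟨fun _ h => by rwa [mem_singleton_iff.1 h],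
    tendstoUniformlyOn_singleton_iff_tendsto.2 hε.2⟩

/-- On `A0 (1 / 50)`, the conditions `a' ± 1 ∈ A` give `|a' / 2| < 1/100`, and with `a + a' ∈ A`
they put `(1 + a) / 2` between `-1/50` and `51/50`: exactly the range of the Bernstein estimate. -/
theorem isRegularSupershift_psi0 {Gm Gp : ℂ → ℂ} (hGm : Differentiable ℂ Gm)
    (hGp : Differentiable ℂ Gp) (hval : Gm (1 / 2) = Gp (1 / 2)) :
    IsRegularSupershift (A0 (1 / 50)) (psi0 Gm Gp) := by
  have hcont : Continuous (psi0 Gm Gp) :=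
    (continuous_glue hGm hGp hval).comp (by fun_prop : Continuous fun a : ℝ => (1 + a) / 2)
  have hunif : ∀ E : Set (ℕ → ℝ), IsUniformNullFamily E →
      ∀ K ⊆ shiftDomain (A0 (1 / 50)), IsCompact K → ∀ δ > 0, ∃ N₀ : ℕ, ∀ N ≥ N₀, ∀ ε ∈ E, ∀ p ∈ K,
        ‖shiftSum (psi0 Gm Gp) ε N p - psi0 Gm Gp (p.1 + p.2)‖ < δ := by
    intro E hE K hK _ δ hδ
    obtain ⟨η, hη, N₁, h⟩ := exists_bernsteinSum_glue_close hGm hGp hval hδ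
    obtain ⟨N₂, hN₂⟩ := eventually_atTop.1 (Metric.tendstoUniformlyOn_iff.1 hE.2 η hη)
    refine ⟨max N₁ N₂ + 1, fun N hN ε hε p hp => ?_⟩
    have hN₁' := le_max_left N₁ N₂
    have hN₂' := le_max_right N₁ N₂
    have hlt : |ε N| < η := by simpa [Real.dist_eq] using hN₂ N (by omega) ε hε
    have hε0 := ((hE.1 ε hε).1 N (by omega)).1
    obtain ⟨hp1, hp2⟩ := hK hp
    have b1 := hp1 (-1) (by norm_num)
    have b2 := hp1 1 (by norm_num)
    simp only [A0, mem_Ioo] at b1 b2 hp2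
    have key := h N (by omega) (1 - ε N) ((1 + p.1) / 2) (p.2 / 2) (by linarith)
      (by linarith [le_abs_self (ε N)]) ⟨by linarith, by linarith⟩
      (abs_le.2 ⟨by linarith, by linarith⟩)
    rw [shiftSum_psi0 Gm Gp ε (by omega), psi0]
    have e : (1 + (p.1 + p.2)) / 2 = p.2 / 2 + (1 + p.1) / 2 := by ring
    rwa [e]
  refine ⟨isOpen_Ioo, ordConnected_Ioo, ⟨-(1 + 1 / 100), ?_, 1 + 1 / 100, ?_, by norm_num⟩,
    hcont.continuousOn, fun ε hε => ⟨hcont.continuousOn, fun K hK hKc => ?_⟩, hunif⟩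
  · constructor <;> norm_num
  · constructor <;> norm_num
  · refine Metric.tendstoUniformlyOn_iff.2 fun δ hδ => ?_
    obtain ⟨N₀, h⟩ := hunif {ε} (isUniformNullFamily_singleton hε) K hK hKc δ hδ
    filter_upwards [eventually_ge_atTop N₀] with N hN p hp
    rw [dist_comm, dist_eq_norm]
    exact h N hN ε rfl p hp


/-! ### The change of variable and the irregular nodes. -/

theorem tan_pi_div_pos {ρ₀ : ℝ} (hρ : 0 < ρ₀) : 0 < Real.tan (Real.pi / (2 * (1 + ρ₀))) := by
  have hπ := Real.pi_pos
  refine Real.tan_pos_of_pos_of_lt_pi_div_two (by positivity) ?_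
  gcongr
  linarith

theorem strictMono_Theta {ρ₀ : ℝ} (hρ : 0 < ρ₀) : StrictMono (Theta ρ₀) := fun a b hab => by
  have hπ := Real.pi_pos
  have := tan_pi_div_pos hρ
  unfold Theta
  gcongr

theorem contDiff_Theta (ρ₀ : ℝ) {n : WithTop ℕ∞} : ContDiff ℝ n (Theta ρ₀) :=
  contDiff_const.mul (Real.contDiff_arctan.comp (contDiff_id.mul contDiff_const))

theorem range_Theta {ρ₀ : ℝ} (hρ : 0 < ρ₀) : range (Theta ρ₀) = A0 ρ₀ := by
  have hπ := Real.pi_pos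
  have ht := tan_pi_div_pos hρ
  ext y
  have hc : 0 < 2 * (1 + ρ₀) / Real.pi := by positivity
  have e : 2 * (1 + ρ₀) / Real.pi * (Real.pi / 2) = 1 + ρ₀ := by field_simp
  constructor
  · rintro ⟨a, rfl⟩
    have h1 := mul_lt_mul_of_pos_left
      (Real.neg_pi_div_two_lt_arctan (a * Real.tan (Real.pi / (2 * (1 + ρ₀))))) hc
    have h2 := mul_lt_mul_of_pos_left
      (Real.arctan_lt_pi_div_two (a * Real.tan (Real.pi / (2 * (1 + ρ₀))))) hc
    constructor <;> unfold Theta <;> linarith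
  · rintro ⟨h1, h2⟩
    refine ⟨Real.tan (y / (2 * (1 + ρ₀) / Real.pi)) / Real.tan (Real.pi / (2 * (1 + ρ₀))), ?_⟩
    unfold Theta
    rw [div_mul_cancel₀ _ ht.ne', Real.arctan_tan, mul_div_cancel₀ _ hc.ne']
    · rw [lt_div_iff₀ hc]; linarith
    · rw [div_lt_iff₀ hc]; linarith

theorem Theta_zero (ρ₀ : ℝ) : Theta ρ₀ 0 = 0 := by simp [Theta]

theorem Theta_neg (ρ₀ a : ℝ) : Theta ρ₀ (-a) = -Theta ρ₀ a := by
  simp [Theta, neg_mul, Real.arctan_neg]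

/-- The tangent factor is the normalisation that fixes `1`; with oddness and monotonicity it
confines the irregular nodes to `[-1, 1]`. -/
theorem Theta_one {ρ₀ : ℝ} (hρ : 0 < ρ₀) : Theta ρ₀ 1 = 1 := by
  have hπ := Real.pi_pos
  unfold Theta
  rw [one_mul, Real.arctan_tan]
  · field_simp
  · exact (neg_lt_zero.2 (by positivity)).trans (by positivity)
  · gcongr; linarith

theorem hasDerivAt_Theta_zero (ρ₀ : ℝ) :
    HasDerivAt (Theta ρ₀)
      (2 * (1 + ρ₀) / Real.pi * Real.tan (Real.pi / (2 * (1 + ρ₀)))) 0 := by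
  have h := (((hasDerivAt_id (0 : ℝ)).mul_const
    (Real.tan (Real.pi / (2 * (1 + ρ₀))))).arctan).const_mul (2 * (1 + ρ₀) / Real.pi)
  exact h.congr_deriv (by simp)

theorem regularNode_mem_Icc {ε : ℕ → ℝ} (hε : IsNullSeq ε) {N ν : ℕ} (hN : 1 ≤ N) (hν : ν ≤ N) :
    regularNode ε N ν ∈ Icc (-1 : ℝ) 1 := by
  obtain ⟨h0, h1⟩ := hε.1 N hN
  have hνN : (ν : ℝ) ≤ N := by exact_mod_cast hν
  have hν0 : (0 : ℝ) ≤ ν := Nat.cast_nonneg _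
  have a1 : 0 ≤ ((ν : ℝ) + ε N * ((N : ℝ) - ν)) / N := by
    have : 0 ≤ (N : ℝ) - ν := sub_nonneg.2 hνN
    positivity
  have a2 : ((ν : ℝ) + ε N * ((N : ℝ) - ν)) / N ≤ 1 :=
    div_le_one_of_le₀ (by nlinarith) (Nat.cast_nonneg _)
  constructor <;> unfold regularNode <;> linarith

theorem regularNode_succ_le {ε : ℕ → ℝ} (hε : IsNullSeq ε) {N : ℕ} (hN : 1 ≤ N) (ν : ℕ) :
    regularNode ε N (ν + 1) ≤ regularNode ε N ν := by
  obtain ⟨h0, h1⟩ := hε.1 N hN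
  unfold regularNode
  push_cast
  gcongr 1 - 2 * (?_ / _)
  linarith

/-- Regular nodes lie in `[-1, 1]`, inside the range of `Theta`, so `Function.invFun` returns a true
preimage and not its default value. -/
theorem Theta_irregularNode {ρ₀ : ℝ} (hρ : 0 < ρ₀) {ε : ℕ → ℝ} (hε : IsNullSeq ε) {N ν : ℕ}
    (hN : 1 ≤ N) (hν : ν ≤ N) :
    Theta ρ₀ (irregularNode ρ₀ ε N ν) = regularNode ε N ν := by
  have h := regularNode_mem_Icc hε hN hν
  have : regularNode ε N ν ∈ range (Theta ρ₀) := by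
    rw [range_Theta hρ]
    exact ⟨by linarith [h.1], by linarith [h.2]⟩
  exact Function.invFun_eq this

theorem irregularNode_mem_Icc {ρ₀ : ℝ} (hρ : 0 < ρ₀) {ε : ℕ → ℝ} (hε : IsNullSeq ε) {N ν : ℕ}
    (hN : 1 ≤ N) (hν : ν ≤ N) : irregularNode ρ₀ ε N ν ∈ Icc (-1 : ℝ) 1 := by
  have h := regularNode_mem_Icc hε hN hν
  rw [← Theta_irregularNode hρ hε hN hν] at h
  have hm := strictMono_Theta hρ
  constructor
  · rw [← hm.le_iff_le, Theta_neg, Theta_one hρ]; exact h.1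
  · rw [← hm.le_iff_le, Theta_one hρ]; exact h.2

theorem irregularNode_succ_le {ρ₀ : ℝ} (hρ : 0 < ρ₀) {ε : ℕ → ℝ} (hε : IsNullSeq ε) {N ν : ℕ}
    (hN : 1 ≤ N) (hν : ν < N) : irregularNode ρ₀ ε N (ν + 1) ≤ irregularNode ρ₀ ε N ν := by
  rw [← (strictMono_Theta hρ).le_iff_le, Theta_irregularNode hρ hε hN hν,
    Theta_irregularNode hρ hε hN hν.le]
  exact regularNode_succ_le hε hN ν

/-! ### Regularity of the transported function and convergence of its sums. -/

theorem continuous_psi {Gm Gp : ℂ → ℂ} (hGm : Differentiable ℂ Gm) (hGp : Differentiable ℂ Gp)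
    (hval : Gm (1 / 2) = Gp (1 / 2)) (ρ₀ : ℝ) : Continuous (psi Gm Gp ρ₀) :=
  ((continuous_glue hGm hGp hval).comp (by fun_prop : Continuous fun a : ℝ => (1 + a) / 2)).comp
    (contDiff_Theta ρ₀ (n := 0)).continuous

theorem hasDerivAt_entire_comp_Theta {G : ℂ → ℂ} (hG : Differentiable ℂ G) (ρ₀ : ℝ) :
    HasDerivAt (fun a : ℝ => G (((1 + Theta ρ₀ a) / 2 : ℝ) : ℂ))
      (deriv G (1 / 2) * ((2 * (1 + ρ₀) / Real.pi *
        Real.tan (Real.pi / (2 * (1 + ρ₀))) / 2 : ℝ) : ℂ)) 0 := by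
  have h1 := (((hasDerivAt_Theta_zero ρ₀).const_add 1).div_const 2).ofReal_comp
  have h2 : HasDerivAt G (deriv G (1 / 2)) (((1 + Theta ρ₀ 0) / 2 : ℝ) : ℂ) := by
    rw [Theta_zero]
    push_cast
    rw [add_zero]
    exact (hG _).hasDerivAt
  exact HasDerivAt.comp (h := fun a : ℝ => (((1 + Theta ρ₀ a) / 2 : ℝ) : ℂ)) 0 h2 h1

theorem not_differentiableAt_psi_zero {Gm Gp : ℂ → ℂ} (hGm : Differentiable ℂ Gm)
    (hGp : Differentiable ℂ Gp) (hval : Gm (1 / 2) = Gp (1 / 2))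
    (hderiv : deriv Gm (1 / 2) ≠ deriv Gp (1 / 2)) {ρ₀ : ℝ} (hρ : 0 < ρ₀) :
    ¬ DifferentiableAt ℝ (psi Gm Gp ρ₀) 0 := by
  intro hd
  have hm := strictMono_Theta hρ
  have hp : ∀ a ∈ Ici (0 : ℝ), psi Gm Gp ρ₀ a = Gp (((1 + Theta ρ₀ a) / 2 : ℝ) : ℂ) := by
    intro a ha
    have : 0 ≤ Theta ρ₀ a := by rw [← Theta_zero ρ₀]; exact hm.monotone ha
    exact if_neg (by linarith)
  have hmn : ∀ a ∈ Iic (0 : ℝ), psi Gm Gp ρ₀ a = Gm (((1 + Theta ρ₀ a) / 2 : ℝ) : ℂ) := by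
    intro a ha
    rcases (mem_Iic.1 ha).eq_or_lt with rfl | ha
    · rw [hp 0 (mem_Ici.2 le_rfl), Theta_zero]
      push_cast
      rw [add_zero, hval]
    · have : Theta ρ₀ a < 0 := by rw [← Theta_zero ρ₀]; exact hm ha
      exact if_pos (by linarith)
  -- A derivative at `0` would equal both one-sided derivatives; cancelling the positive factor
  -- `Theta'(0) / 2` would then equate the derivatives of `Gm` and `Gp` at `1/2`.
  have e1 := (uniqueDiffWithinAt_Ici (0 : ℝ)).eq_deriv _ hd.hasDerivAt.hasDerivWithinAt
    ((hasDerivAt_entire_comp_Theta hGp ρ₀).hasDerivWithinAt.congr hp (hp 0 (mem_Ici.2 le_rfl)))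
  have e2 := (uniqueDiffWithinAt_Iic (0 : ℝ)).eq_deriv _ hd.hasDerivAt.hasDerivWithinAt
    ((hasDerivAt_entire_comp_Theta hGm ρ₀).hasDerivWithinAt.congr hmn (hmn 0 (mem_Iic.2 le_rfl)))
  refine hderiv (mul_right_cancel₀ ?_ (e2.symm.trans e1))
  have hπ := Real.pi_pos
  have ht := tan_pi_div_pos hρ
  exact Complex.ofReal_ne_zero.2 (by positivity)

theorem analyticOnNhd_extrapolation (ρ₀ : ℝ) (f : ℝ → ℂ) (ε : ℕ → ℝ) (N : ℕ) :
    AnalyticOnNhd ℝ (extrapolation ρ₀ f ε N) univ := by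
  rw [← contDiff_omega_iff_analyticOnNhd]
  unfold extrapolation weight
  -- In `WithTop ℕ∞`, `⊤` is the analytic order `ω`, not merely `C^∞`.
  have hT : ContDiff ℝ ⊤ (Theta ρ₀) := contDiff_Theta ρ₀
  refine ContDiff.sum fun ν _ => ContDiff.mul (Complex.ofRealCLM.contDiff.comp ?_) contDiff_const
  have h : ContDiff ℝ ⊤ fun a => (N.choose ν : ℝ) * ((1 + Theta ρ₀ a) / 2) ^ (N - ν) *
      ((1 - Theta ρ₀ a) / 2) ^ ν := by fun_prop
  exact h

theorem extrapolation_psi {Gm Gp : ℂ → ℂ} {ρ₀ : ℝ} (hρ : 0 < ρ₀) {ε : ℕ → ℝ} (hε : IsNullSeq ε)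
    {N : ℕ} (hN : 1 ≤ N) (a : ℝ) :
    extrapolation ρ₀ (psi Gm Gp ρ₀) ε N a = shiftSum (psi0 Gm Gp) ε N (Theta ρ₀ a, 0) := by
  refine Finset.sum_congr rfl fun ν hν => ?_
  rw [psi, Function.comp_apply,
    Theta_irregularNode hρ hε hN (Nat.lt_succ_iff.1 (Finset.mem_range.1 hν)), zero_add]

theorem Theta_image_prod_subset {ρ₀ : ℝ} (hρ : 0 < ρ₀) (K : Set ℝ) :
    (fun a => (Theta ρ₀ a, (0 : ℝ))) '' K ⊆ shiftDomain (A0 ρ₀) := by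
  rintro _ ⟨a, -, rfl⟩
  refine ⟨fun t ht => ⟨?_, ?_⟩, ?_⟩
  · linarith [ht.1]
  · linarith [ht.2]
  · rw [add_zero, ← range_Theta hρ]
    exact mem_range_self a

theorem exists_extrapolation_psi_close {Gm Gp : ℂ → ℂ} {ρ₀ : ℝ} (hρ : 0 < ρ₀)
    (hreg : IsRegularSupershift (A0 ρ₀) (psi0 Gm Gp)) {E : Set (ℕ → ℝ)}
    (hE : IsUniformNullFamily E) {K : Set ℝ} (hK : IsCompact K) {δ : ℝ} (hδ : 0 < δ) :
    ∃ N₀ : ℕ, ∀ N ≥ N₀, ∀ ε ∈ E, ∀ a ∈ K,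
      ‖extrapolation ρ₀ (psi Gm Gp ρ₀) ε N a - psi Gm Gp ρ₀ a‖ < δ := by
  have hc : Continuous fun a => (Theta ρ₀ a, (0 : ℝ)) :=
    (contDiff_Theta ρ₀ (n := 0)).continuous.prodMk continuous_const
  obtain ⟨N₀, h⟩ := hreg.uniform E hE _ (Theta_image_prod_subset hρ K) (hK.image hc) δ hδ
  -- The node identity needs `N ≥ 1`.
  refine ⟨max N₀ 1, fun N hN ε hε a ha => ?_⟩
  have := h N (le_of_max_le_left hN) ε hε _ (mem_image_of_mem _ ha)
  rwa [← extrapolation_psi hρ (hE.1 ε hε) (le_of_max_le_right hN), add_zero] at this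

end Supershift

theorem proposition2p9 (Gm Gp : ℂ → ℂ)
    (hGm : Differentiable ℂ Gm) (hGp : Differentiable ℂ Gp)
    (hval : Gm (1 / 2) = Gp (1 / 2)) (hderiv : deriv Gm (1 / 2) ≠ deriv Gp (1 / 2)) :
    -- an interval `A₀` on which `ψ₀` is a regular supershift exists
    (∃ ρ₀ : ℝ, 0 < ρ₀ ∧ Supershift.IsRegularSupershift (Supershift.A0 ρ₀) (Supershift.psi0 Gm Gp)) ∧
    -- and for every such interval:
    ∀ ρ₀ : ℝ, 0 < ρ₀ →
      Supershift.IsRegularSupershift (Supershift.A0 ρ₀) (Supershift.psi0 Gm Gp) →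
      -- `Θ` is a real-analytic homeomorphism of `ℝ` onto `A₀`
      (AnalyticOnNhd ℝ (Supershift.Theta ρ₀) Set.univ ∧
        Topology.IsEmbedding (Supershift.Theta ρ₀) ∧
        Set.range (Supershift.Theta ρ₀) = Supershift.A0 ρ₀) ∧
      -- the irregular nodes are well defined, lie in `[-1,1]` and are listed in decreasing order
      (∀ ε : ℕ → ℝ, Supershift.IsNullSeq ε → ∀ N : ℕ, 1 ≤ N →
        (∀ ν ≤ N,
          Supershift.Theta ρ₀ (Supershift.irregularNode ρ₀ ε N ν) = Supershift.regularNode ε N ν ∧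
          Supershift.irregularNode ρ₀ ε N ν ∈ Set.Icc (-1 : ℝ) 1) ∧
        (∀ ν < N,
          Supershift.irregularNode ρ₀ ε N (ν + 1) ≤ Supershift.irregularNode ρ₀ ε N ν)) ∧
      -- `ψ` is continuous and not real-analytic on `ℝ`
      Continuous (Supershift.psi Gm Gp ρ₀) ∧
      ¬ AnalyticOnNhd ℝ (Supershift.psi Gm Gp ρ₀) Set.univ ∧
      -- the sums are real-analytic and converge to `ψ` uniformly on compact sets
      (∀ ε : ℕ → ℝ, Supershift.IsNullSeq ε →
        (∀ N : ℕ, 1 ≤ N → AnalyticOnNhd ℝ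
          (Supershift.extrapolation ρ₀ (Supershift.psi Gm Gp ρ₀) ε N) Set.univ) ∧
        ∀ K : Set ℝ, IsCompact K →
          TendstoUniformlyOn (Supershift.extrapolation ρ₀ (Supershift.psi Gm Gp ρ₀) ε)
            (Supershift.psi Gm Gp ρ₀) Filter.atTop K) ∧
      -- uniformly over families of `ε` that tend to `0` uniformly
      (∀ E : Set (ℕ → ℝ), Supershift.IsUniformNullFamily E →
        ∀ K : Set ℝ, IsCompact K → ∀ δ > 0, ∃ N₀ : ℕ, ∀ N ≥ N₀, ∀ ε ∈ E, ∀ a ∈ K,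
          ‖Supershift.extrapolation ρ₀ (Supershift.psi Gm Gp ρ₀) ε N a
            - Supershift.psi Gm Gp ρ₀ a‖ < δ) := by

  refine ⟨⟨1 / 50, by norm_num, Supershift.isRegularSupershift_psi0 hGm hGp hval⟩,
    fun ρ₀ hρ hreg => ⟨⟨?_, ?_, Supershift.range_Theta hρ⟩, ?_,
      Supershift.continuous_psi hGm hGp hval ρ₀, ?_, ?_, ?_⟩⟩
  · exact contDiff_omega_iff_analyticOnNhd.1 (Supershift.contDiff_Theta ρ₀)
  · refine (Supershift.strictMono_Theta hρ).isEmbedding_of_ordConnected ?_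
    rw [Supershift.range_Theta hρ]
    exact Set.ordConnected_Ioo
  · exact fun ε hε N hN => ⟨fun ν hν => ⟨Supershift.Theta_irregularNode hρ hε hN hν,
      Supershift.irregularNode_mem_Icc hρ hε hN hν⟩,
      fun ν hν => Supershift.irregularNode_succ_le hρ hε hN hν⟩
  · exact fun h => Supershift.not_differentiableAt_psi_zero hGm hGp hval hderiv hρ
      (h 0 (Set.mem_univ _)).differentiableAt
  · refine fun ε hε => ⟨fun N _ => Supershift.analyticOnNhd_extrapolation ρ₀ _ ε N,
      fun K hK => Metric.tendstoUniformlyOn_iff.2 fun δ hδ => ?_⟩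
    obtain ⟨N₀, h⟩ := Supershift.exists_extrapolation_psi_close hρ hreg
      (Supershift.isUniformNullFamily_singleton hε) hK hδ
    filter_upwards [Filter.eventually_ge_atTop N₀] with N hN a ha
    rw [dist_comm, dist_eq_norm]
    exact h N hN ε rfl a ha
  · exact fun E hE K hK δ hδ => Supershift.exists_extrapolation_psi_close hρ hreg hE hK hδ
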